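/- Work in the two-sorted language $L_2$ of second order arithmetic. $\mathsf{RCA}_0$ is the theory consisting of the basic axioms for $0,1,+,\cdot,<$ ($n+1\neq 0$; $m+1=n+1\to m=n$; $m+0=m$; $m+(n+1)=(m+n)+1$; $m\cdot 0=0$; $m\cdot(n+1)=m\cdot n+m$; $\neg\, m<0$; $m<n+1\leftrightarrow(m<n\lor m=n)$), induction for $\Sigma^0_1$-formulas and comprehension for $\Delta^0_1$-formulas, where number and set parameters are allowed. Let $\mathsf{I}\Sigma^0_2$ be the scheme $(\varphi(0)\land\forall n\,(\varphi(n)\to\varphi(n+1)))\to\forall n\,\varphi(n)$ for all $\Sigma^0_2$-formulas $\varphi$ (with parameters). Let $\mathsf{SPP}$ (the strong pigeonhole principle) be the statement: for every $k\in\mathbb N$ and every coloring $c\colon\mathbb N\to k=\{0,\dots,k-1\}$ there exists a set $I\subseteq k$ such that for all $i$, $$ i\in I\iff i<k \text{ and } c(x)=i \text{ for infinitely many } x. $$ Then, over $\mathsf{RCA}_0$, $\mathsf{I}\Sigma^0_2$ and $\mathsf{SPP}$ are equivalent: a model of $\mathsf{RCA}_0$ (an $L_2$-structure whose set variables range over an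 arbitrary nonempty family of subsets of its number domain) satisfies $\mathsf{I}\Sigma^0_2$ if and only if it satisfies $\mathsf{SPP}$. -/

import Mathlib

/-!
Second order arithmetic: the two-sorted language `L₂`, its structures, the theory `RCA₀`, the scheme
`IΣ⁰₂` and the sentence `SPP`.

Number variables and set variables are de Bruijn indices, counted separately: a number quantifier
binds number variable `0` of its body and a set quantifier binds set variable `0` of its body.
-/

namespace SOA

/-- `push a e` is the sequence `a, e 0, e 1, …`. -/
def push {α : Type*} (a : α) (e : ℕ → α) : ℕ → α
  | 0 => a
  | i + 1 => e i

@[simp] theorem push_zero {α : Type*} (a : α) (e : ℕ → α) : push a e 0 = a := rfl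

@[simp] theorem push_succ {α : Type*} (a : α) (e : ℕ → α) (i : ℕ) : push a e (i + 1) = e i := rfl

@[simp] theorem push_one {α : Type*} (a : α) (e : ℕ → α) : push a e 1 = e 0 := rfl

@[simp] theorem push_two {α : Type*} (a : α) (e : ℕ → α) : push a e 2 = e 1 := rfl

@[simp] theorem push_three {α : Type*} (a : α) (e : ℕ → α) : push a e 3 = e 2 := rfl

/-! ### Syntax of the language of second order arithmetic -/

/-- Numerical terms. -/
inductive Term : Type
  | var (i : ℕ)
  | zero
  | one
  | add (s t : Term)
  | mul (s t : Term)

/-- Formulas. `mem t X` is `t ∈ X` for the set variable with index `X`. -/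
inductive Formula : Type
  | eq (s t : Term)
  | lt (s t : Term)
  | mem (t : Term) (X : ℕ)
  | neg (φ : Formula)
  | conj (φ ψ : Formula)
  | disj (φ ψ : Formula)
  | imp (φ ψ : Formula)
  | all (φ : Formula)
  | ex (φ : Formula)
  | allSet (φ : Formula)
  | exSet (φ : Formula)

/-- Simultaneous substitution of terms for number variables. -/
def Term.subst (σ : ℕ → Term) : Term → Term
  | var i => σ i
  | zero => zero
  | one => one
  | add s t => add (s.subst σ) (t.subst σ)
  | mul s t => mul (s.subst σ) (t.subst σ)

/-- The term `t`, read below one more number quantifier. -/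
def Term.shift (t : Term) : Term := t.subst fun i => Term.var (i + 1)

/-- Capture-avoiding simultaneous substitution of terms for the free number variables. -/
def Formula.subst : (ℕ → Term) → Formula → Formula
  | σ, eq s t => eq (s.subst σ) (t.subst σ)
  | σ, lt s t => lt (s.subst σ) (t.subst σ)
  | σ, mem t X => mem (t.subst σ) X
  | σ, neg φ => neg (φ.subst σ)
  | σ, conj φ ψ => conj (φ.subst σ) (ψ.subst σ)
  | σ, disj φ ψ => disj (φ.subst σ) (ψ.subst σ)
  | σ, imp φ ψ => imp (φ.subst σ) (ψ.subst σ)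
  | σ, all φ => all (φ.subst (push (Term.var 0) fun i => (σ i).shift))
  | σ, ex φ => ex (φ.subst (push (Term.var 0) fun i => (σ i).shift))
  | σ, allSet φ => allSet (φ.subst σ)
  | σ, exSet φ => exSet (φ.subst σ)

/-- Renaming of the free set variables. -/
def Formula.renameSet : (ℕ → ℕ) → Formula → Formula
  | _, eq s t => eq s t
  | _, lt s t => lt s t
  | ρ, mem t X => mem t (ρ X)
  | ρ, neg φ => neg (φ.renameSet ρ)
  | ρ, conj φ ψ => conj (φ.renameSet ρ) (ψ.renameSet ρ)
  | ρ, disj φ ψ => disj (φ.renameSet ρ) (ψ.renameSet ρ)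
  | ρ, imp φ ψ => imp (φ.renameSet ρ) (ψ.renameSet ρ)
  | ρ, all φ => all (φ.renameSet ρ)
  | ρ, ex φ => ex (φ.renameSet ρ)
  | ρ, allSet φ => allSet (φ.renameSet (push 0 fun i => ρ i + 1))
  | ρ, exSet φ => exSet (φ.renameSet (push 0 fun i => ρ i + 1))

/-- `φ ↔ ψ`. -/
def Formula.iff (φ ψ : Formula) : Formula := (φ.imp ψ).conj (ψ.imp φ)

/-- The bounded quantifier `∀ n < t, φ(n)`; the term `t` does not contain `n`. -/
def Formula.allLt (t : Term) (φ : Formula) : Formula :=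
  .all ((Formula.lt (.var 0) t.shift).imp φ)

/-- The bounded quantifier `∃ n < t, φ(n)`; the term `t` does not contain `n`. -/
def Formula.exLt (t : Term) (φ : Formula) : Formula :=
  .ex ((Formula.lt (.var 0) t.shift).conj φ)

/-- Bounded quantifier formulas (`Σ⁰₀`); free number and set variables are allowed. -/
inductive Formula.IsBounded : Formula → Prop
  | eq (s t : Term) : IsBounded (.eq s t)
  | lt (s t : Term) : IsBounded (.lt s t)
  | mem (t : Term) (X : ℕ) : IsBounded (.mem t X)
  | neg {φ : Formula} : IsBounded φ → IsBounded φ.neg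
  | conj {φ ψ : Formula} : IsBounded φ → IsBounded ψ → IsBounded (φ.conj ψ)
  | disj {φ ψ : Formula} : IsBounded φ → IsBounded ψ → IsBounded (φ.disj ψ)
  | imp {φ ψ : Formula} : IsBounded φ → IsBounded ψ → IsBounded (φ.imp ψ)
  | allLt (t : Term) {φ : Formula} : IsBounded φ → IsBounded (φ.allLt t)
  | exLt (t : Term) {φ : Formula} : IsBounded φ → IsBounded (φ.exLt t)

/-- `Σ⁰₁` formulas: `∃ m θ` with `θ` a bounded quantifier formula. -/
def Formula.IsSigma1 (φ : Formula) : Prop := ∃ θ : Formula, θ.IsBounded ∧ φ = θ.ex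

/-- `Π⁰₁` formulas: `∀ m θ` with `θ` a bounded quantifier formula. -/
def Formula.IsPi1 (φ : Formula) : Prop := ∃ θ : Formula, θ.IsBounded ∧ φ = θ.all

/-- `Σ⁰₂` formulas: `∃ m ∀ n θ` with `θ` a bounded quantifier formula. -/
def Formula.IsSigma2 (φ : Formula) : Prop := ∃ θ : Formula, θ.IsBounded ∧ φ = θ.all.ex

/-! ### Semantics -/

/-- Structures for the language of second order arithmetic with number domain `M`: set variables
range over an arbitrary nonempty family of subsets of `M`. -/
structure L2Structure (M : Type*) where
  zero : M
  one : M
  add : M → M → M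
  mul : M → M → M
  lt : M → M → Prop
  sets : Set (Set M)
  sets_nonempty : sets.Nonempty

variable {M : Type*}

/-- The value of a term. -/
def Term.eval (S : L2Structure M) (e : ℕ → M) : Term → M
  | var i => e i
  | zero => S.zero
  | one => S.one
  | add s t => S.add (s.eval S e) (t.eval S e)
  | mul s t => S.mul (s.eval S e) (t.eval S e)

/-- Truth of a formula under an assignment `e` of numbers and `E` of sets. -/
def Formula.Realize (S : L2Structure M) : (ℕ → M) → (ℕ → S.sets) → Formula → Prop
  | e, _, eq s t => s.eval S e = t.eval S e
  | e, _, lt s t => S.lt (s.eval S e) (t.eval S e)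
  | e, E, mem t X => t.eval S e ∈ (E X : Set M)
  | e, E, neg φ => ¬ φ.Realize S e E
  | e, E, conj φ ψ => φ.Realize S e E ∧ ψ.Realize S e E
  | e, E, disj φ ψ => φ.Realize S e E ∨ ψ.Realize S e E
  | e, E, imp φ ψ => φ.Realize S e E → ψ.Realize S e E
  | e, E, all φ => ∀ a : M, φ.Realize S (push a e) E
  | e, E, ex φ => ∃ a : M, φ.Realize S (push a e) E
  | e, E, allSet φ => ∀ X : S.sets, φ.Realize S e (push X E)
  | e, E, exSet φ => ∃ X : S.sets, φ.Realize S e (push X E)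

/-- The structure satisfies (the universal closure of) the formula. -/
def L2Structure.Satisfies (S : L2Structure M) (φ : Formula) : Prop :=
  ∀ (e : ℕ → M) (E : ℕ → S.sets), φ.Realize S e E

/-- The structure is a model of the set of axioms `T`. -/
def L2Structure.Models (S : L2Structure M) (T : Set Formula) : Prop :=
  ∀ φ ∈ T, S.Satisfies φ

/-! ### The axioms -/

/-- The basic axioms
`n + 1 ≠ 0`, `m + 1 = n + 1 → m = n`, `m + 0 = m`, `m + (n + 1) = (m + n) + 1`,
`m · 0 = 0`, `m · (n + 1) = m · n + m`, `¬ m < 0`, `m < n + 1 ↔ (m < n ∨ m = n)`. -/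
def basicAxioms : Set Formula :=
  let m : Term := .var 0
  let n : Term := .var 1
  { .neg (.eq (.add n .one) .zero),
    .imp (.eq (.add m .one) (.add n .one)) (.eq m n),
    .eq (.add m .zero) m,
    .eq (.add m (.add n .one)) (.add (.add m n) .one),
    .eq (.mul m .zero) .zero,
    .eq (.mul m (.add n .one)) (.add (.mul m n) m),
    .neg (.lt m .zero),
    .iff (.lt m (.add n .one)) (.disj (.lt m n) (.eq m n)) }

/-- The induction axiom `(φ(0) ∧ ∀ n (φ(n) → φ(n + 1))) → ∀ n φ(n)`, where `n` is number variable
`0` of `φ` and all other free variables of `φ` are parameters. -/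
def inductionAxiom (φ : Formula) : Formula :=
  .imp
    (.conj (φ.subst (push .zero .var))
      (.all (.imp φ (φ.subst (push (.add (.var 0) .one) fun i => .var (i + 1))))))
    (.all φ)

/-- The comprehension axiom `∀ n (φ(n) ↔ ψ(n)) → ∃ X ∀ n (n ∈ X ↔ φ(n))`, where `n` is number
variable `0` and `X` is not free in `φ`; all other free variables are parameters. -/
def comprehensionAxiom (φ ψ : Formula) : Formula :=
  .imp (.all (φ.iff ψ))
    (.exSet (.all (.iff (.mem (.var 0) 0) (φ.renameSet fun X => X + 1))))

/-- `RCA₀`: basic axioms, `Σ⁰₁` induction and `Δ⁰₁` comprehension. -/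
def RCA0 : Set Formula :=
  basicAxioms ∪ {χ | ∃ φ : Formula, φ.IsSigma1 ∧ χ = inductionAxiom φ} ∪
    {χ | ∃ φ ψ : Formula, φ.IsSigma1 ∧ ψ.IsPi1 ∧ χ = comprehensionAxiom φ ψ}

/-- `IΣ⁰₂`: the scheme of `Σ⁰₂` induction. -/
def ISigma2 : Set Formula := {χ | ∃ φ : Formula, φ.IsSigma2 ∧ χ = inductionAxiom φ}

/-- The usual code `(s + t)² + s` of the ordered pair `(s, t)`. -/
def pairTerm (s t : Term) : Term := .add (.mul (.add s t) (.add s t)) s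

/-- With `k` number variable `0` and `C` set variable `0`: `C` is (the graph of) a function from
`ℕ` to `{i : i < k}`, i.e. every element of `C` is a pair `(x, i)` with `i < k`, every `x` has a
value, and values are unique. -/
def isColoring : Formula :=
  .conj
    (.all (.imp (.mem (.var 0) 0)
      (.ex (.ex (.conj (.lt (.var 0) (.var 3)) (.eq (.var 2) (pairTerm (.var 1) (.var 0))))))))
    (.conj
      (.all (.ex (.mem (pairTerm (.var 1) (.var 0)) 0)))
      (.all (.all (.all (.imp
        (.conj (.mem (pairTerm (.var 2) (.var 1)) 0) (.mem (pairTerm (.var 2) (.var 0)) 0))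
        (.eq (.var 1) (.var 0)))))))

/-- The strong pigeonhole principle: for all `k` and all `C : ℕ → k` there is a set `I` with
`∀ i (i ∈ I ↔ i < k ∧ ∀ y ∃ x > y, C(x) = i)`. The theorem `satisfies_SPP` below spells it out. -/
def SPP : Formula :=
  .all (.allSet (.imp isColoring
    (.exSet (.all (.iff (.mem (.var 0) 0)
      (.conj (.lt (.var 0) (.var 1))
        (.all (.ex (.conj (.lt (.var 1) (.var 0)) (.mem (pairTerm (.var 0) (.var 2)) 1))))))))))

/-! ### What satisfaction of these axioms means -/

theorem Term.eval_subst (S : L2Structure M) (e : ℕ → M) (σ : ℕ → Term) (t : Term) :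
    (t.subst σ).eval S e = t.eval S fun i => (σ i).eval S e := by
  induction t with
  | var i => rfl
  | zero => rfl
  | one => rfl
  | add s t hs ht => simp only [Term.subst, Term.eval, hs, ht]
  | mul s t hs ht => simp only [Term.subst, Term.eval, hs, ht]

theorem Term.eval_shift (S : L2Structure M) (a : M) (e : ℕ → M) (t : Term) :
    t.shift.eval S (push a e) = t.eval S e :=
  Term.eval_subst S (push a e) _ t

theorem eval_push_lift (S : L2Structure M) (a : M) (e : ℕ → M) (σ : ℕ → Term) :
    (fun i => (push (Term.var 0) (fun i => (σ i).shift) i).eval S (push a e)) =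
      push a fun i => (σ i).eval S e := by
  funext i
  cases i with
  | zero => rfl
  | succ i => exact Term.eval_shift S a e (σ i)

theorem Formula.realize_subst (S : L2Structure M) (φ : Formula) :
    ∀ (e : ℕ → M) (E : ℕ → S.sets) (σ : ℕ → Term),
      (φ.subst σ).Realize S e E ↔ φ.Realize S (fun i => (σ i).eval S e) E := by
  induction φ with
  | eq s t => intro e E σ; simp only [Formula.subst, Formula.Realize, Term.eval_subst]
  | lt s t => intro e E σ; simp only [Formula.subst, Formula.Realize, Term.eval_subst]
  | mem t X => intro e E σ; simp only [Formula.subst, Formula.Realize, Term.eval_subst]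
  | neg φ h => intro e E σ; simp only [Formula.subst, Formula.Realize, h]
  | conj φ ψ h h' => intro e E σ; simp only [Formula.subst, Formula.Realize, h, h']
  | disj φ ψ h h' => intro e E σ; simp only [Formula.subst, Formula.Realize, h, h']
  | imp φ ψ h h' => intro e E σ; simp only [Formula.subst, Formula.Realize, h, h']
  | all φ h => intro e E σ; simp only [Formula.subst, Formula.Realize, h, eval_push_lift]
  | ex φ h => intro e E σ; simp only [Formula.subst, Formula.Realize, h, eval_push_lift]
  | allSet φ h => intro e E σ; simp only [Formula.subst, Formula.Realize, h]
  | exSet φ h => intro e E σ; simp only [Formula.subst, Formula.Realize, h]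

theorem Formula.realize_iff (S : L2Structure M) (φ ψ : Formula) (e : ℕ → M) (E : ℕ → S.sets) :
    (φ.iff ψ).Realize S e E ↔ (φ.Realize S e E ↔ ψ.Realize S e E) :=
  iff_iff_implies_and_implies.symm

theorem push_comp_lift {α : Type*} (a : α) (E : ℕ → α) (ρ : ℕ → ℕ) :
    (fun i => push a E (push 0 (fun i => ρ i + 1) i)) = push a fun i => E (ρ i) := by
  funext i
  cases i <;> rfl

theorem Formula.realize_renameSet (S : L2Structure M) (φ : Formula) :
    ∀ (e : ℕ → M) (E : ℕ → S.sets) (ρ : ℕ → ℕ),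
      (φ.renameSet ρ).Realize S e E ↔ φ.Realize S e fun i => E (ρ i) := by
  induction φ with
  | eq s t => intro e E ρ; rfl
  | lt s t => intro e E ρ; rfl
  | mem t X => intro e E ρ; rfl
  | neg φ h => intro e E ρ; simp only [Formula.renameSet, Formula.Realize, h]
  | conj φ ψ h h' => intro e E ρ; simp only [Formula.renameSet, Formula.Realize, h, h']
  | disj φ ψ h h' => intro e E ρ; simp only [Formula.renameSet, Formula.Realize, h, h']
  | imp φ ψ h h' => intro e E ρ; simp only [Formula.renameSet, Formula.Realize, h, h']
  | all φ h => intro e E ρ; simp only [Formula.renameSet, Formula.Realize, h]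
  | ex φ h => intro e E ρ; simp only [Formula.renameSet, Formula.Realize, h]
  | allSet φ h => intro e E ρ; simp only [Formula.renameSet, Formula.Realize, h, push_comp_lift]
  | exSet φ h => intro e E ρ; simp only [Formula.renameSet, Formula.Realize, h, push_comp_lift]

theorem satisfies_inductionAxiom (S : L2Structure M) (φ : Formula) :
    S.Satisfies (inductionAxiom φ) ↔ ∀ (e : ℕ → M) (E : ℕ → S.sets),
      φ.Realize S (push S.zero e) E →
      (∀ n, φ.Realize S (push n e) E → φ.Realize S (push (S.add n S.one) e) E) →
      ∀ n, φ.Realize S (push n e) E := by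
  have h0 : ∀ e : ℕ → M, (fun i => (push Term.zero Term.var i).eval S e) = push S.zero e := by
    intro e; funext i; cases i <;> rfl
  have h1 : ∀ (n : M) (e : ℕ → M),
      (fun i => (push (Term.add (.var 0) .one) (fun i => Term.var (i + 1)) i).eval S (push n e)) =
        push (S.add n S.one) e := by
    intro n e; funext i; cases i <;> rfl
  simp only [L2Structure.Satisfies, inductionAxiom, Formula.Realize, Formula.realize_subst, h0, h1,
    and_imp]

theorem satisfies_comprehensionAxiom (S : L2Structure M) (φ ψ : Formula) :
    S.Satisfies (comprehensionAxiom φ ψ) ↔ ∀ (e : ℕ → M) (E : ℕ → S.sets),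
      (∀ n, φ.Realize S (push n e) E ↔ ψ.Realize S (push n e) E) →
      ∃ X ∈ S.sets, ∀ n, n ∈ X ↔ φ.Realize S (push n e) E := by
  simp [L2Structure.Satisfies, comprehensionAxiom, Formula.realize_iff, Formula.Realize,
    Formula.realize_renameSet, Term.eval]

/-- The code of an ordered pair, computed in a structure. -/
def L2Structure.pair (S : L2Structure M) (x y : M) : M :=
  S.add (S.mul (S.add x y) (S.add x y)) x

theorem satisfies_SPP (S : L2Structure M) :
    S.Satisfies SPP ↔ ∀ (k : M), ∀ C ∈ S.sets,
      (∀ z ∈ C, ∃ x i, S.lt i k ∧ z = S.pair x i) →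
      (∀ x, ∃ i, S.pair x i ∈ C) →
      (∀ x i j, S.pair x i ∈ C → S.pair x j ∈ C → i = j) →
      ∃ I ∈ S.sets, ∀ i, i ∈ I ↔ S.lt i k ∧ ∀ y, ∃ x, S.lt y x ∧ S.pair x i ∈ C := by
  obtain ⟨X, hX⟩ := S.sets_nonempty
  have : ∀ p : Prop, ((ℕ → M) → (ℕ → S.sets) → p) ↔ p := fun p =>
    ⟨fun h => h (fun _ => S.zero) (fun _ => ⟨X, hX⟩), fun h _ _ => h⟩
  simp only [L2Structure.Satisfies, SPP, isColoring, Formula.realize_iff, Formula.Realize, Term.eval,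
    pairTerm, push_zero, push_one, push_two, push_three, this,
    Subtype.forall, Subtype.exists, exists_prop, and_imp, L2Structure.pair]

end SOA

/-! From `IΣ⁰₂` to `SPP`: the colors below `k` that recur form a `Π⁰₂` set, and the least element
principle makes it a set of the model. A set of colors is coded by Gödel's moduli: with `m`
divisible by `1, …, k`, the numbers `(i + 1) m + 1`, `i < k`, are pairwise coprime, and `t > 0`
codes the `i` whose modulus divides `t`. Take the least `t > 0` such that, for some `b`, every color
not coded by `t` is absent beyond `b`. Recurring colors are coded. A coded color that dies out could
be removed by dividing `t` by its modulus: coprimality (`dvd_of_dvd_mul_moduli`) keeps the other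
colors, against minimality. The set is now defined by a bounded formula in `t`.

From `SPP` to `IΣ⁰₂`: let `φ(i)` be `∃ a ∀ m P`. Then `¬ φ(i)` says that every `a` has an `m`
refuting `P`, which by bounding for bounded formulas means that every initial segment of `a`'s has a
common bound `d` on such `m`. Color a triple `(i, b, d)` by `i` if `d` is the least bound for the `a
< b`. Color `i` recurs exactly when `φ(i)` fails (`infinitely_many_stages_iff`,
`forall_failsBelow_iff`), so `SPP` turns the failures of `φ` up to `n` into a set, and induction
along its complement is bounded induction.

Both halves work in a discretely ordered semiring (`exists_orderedSemiring`). Formulas are handled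
through the closure properties of `TermDef` and `BddDef`. -/

namespace SOA

variable {M : Type*}

/-! ### Definability by terms and by bounded quantifier formulas -/

/-- The operations of `S` are the ambient ones. -/
structure Interprets (S : L2Structure M) [Zero M] [One M] [Add M] [Mul M] [LT M] : Prop where
  zero : S.zero = 0
  one : S.one = 1
  add : ∀ a b, S.add a b = a + b
  mul : ∀ a b, S.mul a b = a * b
  lt : ∀ a b, S.lt a b ↔ a < b

/-- The function `f` of the number variables is the value of a term. -/
def TermDef (S : L2Structure M) (f : (ℕ → M) → M) : Prop :=
  ∃ t : Term, ∀ e, t.eval S e = f e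

/-- The relation `R` of the number variables is defined by a bounded quantifier formula with set
parameters `E`. -/
def BddDef (S : L2Structure M) (E : ℕ → S.sets) (R : (ℕ → M) → Prop) : Prop :=
  ∃ θ : Formula, θ.IsBounded ∧ ∀ e, θ.Realize S e E ↔ R e

theorem Term.subst_subst (σ τ : ℕ → Term) (t : Term) :
    (t.subst σ).subst τ = t.subst fun i => (σ i).subst τ := by
  induction t with
  | var i => rfl
  | zero => rfl
  | one => rfl
  | add s t hs ht => simp only [Term.subst, hs, ht]
  | mul s t hs ht => simp only [Term.subst, hs, ht]

/-- Weakening commutes with substitution. Hence the bound of a bounded quantifier is still a shifted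
term after substitution, as `IsBounded` requires. -/
theorem Term.shift_subst_lift (σ : ℕ → Term) (t : Term) :
    t.shift.subst (push (Term.var 0) fun i => (σ i).shift) = (t.subst σ).shift := by
  simp only [Term.shift, Term.subst_subst, Term.subst, push_succ]

theorem Formula.IsBounded.subst {φ : Formula} (h : φ.IsBounded) :
    ∀ σ, (φ.subst σ).IsBounded := by
  induction h with
  | eq s t => exact fun σ => .eq _ _
  | lt s t => exact fun σ => .lt _ _
  | mem t X => exact fun σ => .mem _ _
  | neg _ h => exact fun σ => .neg (h σ)
  | conj _ _ h h' => exact fun σ => .conj (h σ) (h' σ)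
  | disj _ _ h h' => exact fun σ => .disj (h σ) (h' σ)
  | imp _ _ h h' => exact fun σ => .imp (h σ) (h' σ)
  | allLt t _ h =>
    intro σ
    simp only [Formula.allLt, Formula.subst, Term.shift_subst_lift]
    exact .allLt _ (h _)
  | exLt t _ h =>
    intro σ
    simp only [Formula.exLt, Formula.subst, Term.shift_subst_lift]
    exact .exLt _ (h _)

section Definability

variable {S : L2Structure M} {E : ℕ → S.sets} {f g : (ℕ → M) → M} {P Q : (ℕ → M) → Prop}

theorem TermDef.var (i : ℕ) : TermDef S fun e => e i := ⟨.var i, fun _ => rfl⟩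

theorem BddDef.eq (hf : TermDef S f) (hg : TermDef S g) : BddDef S E fun e => f e = g e := by
  obtain ⟨s, hs⟩ := hf
  obtain ⟨t, ht⟩ := hg
  exact ⟨.eq s t, .eq s t, fun e => by simp only [Formula.Realize, hs, ht]⟩

theorem BddDef.mem (X : ℕ) (hf : TermDef S f) : BddDef S E fun e => f e ∈ (E X : Set M) := by
  obtain ⟨s, hs⟩ := hf
  exact ⟨.mem s X, .mem s X, fun e => by simp only [Formula.Realize, hs]⟩

theorem BddDef.not (hP : BddDef S E P) : BddDef S E fun e => ¬ P e := by
  obtain ⟨φ, hφ, h⟩ := hP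
  exact ⟨φ.neg, hφ.neg, fun e => by simp only [Formula.Realize, h]⟩

theorem BddDef.and (hP : BddDef S E P) (hQ : BddDef S E Q) : BddDef S E fun e => P e ∧ Q e := by
  obtain ⟨φ, hφ, h⟩ := hP
  obtain ⟨ψ, hψ, h'⟩ := hQ
  exact ⟨φ.conj ψ, hφ.conj hψ, fun e => by simp only [Formula.Realize, h, h']⟩

theorem BddDef.or (hP : BddDef S E P) (hQ : BddDef S E Q) : BddDef S E fun e => P e ∨ Q e := by
  obtain ⟨φ, hφ, h⟩ := hP
  obtain ⟨ψ, hψ, h'⟩ := hQ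
  exact ⟨φ.disj ψ, hφ.disj hψ, fun e => by simp only [Formula.Realize, h, h']⟩

theorem BddDef.imp (hP : BddDef S E P) (hQ : BddDef S E Q) : BddDef S E fun e => P e → Q e := by
  obtain ⟨φ, hφ, h⟩ := hP
  obtain ⟨ψ, hψ, h'⟩ := hQ
  exact ⟨φ.imp ψ, hφ.imp hψ, fun e => by simp only [Formula.Realize, h, h']⟩

/-- Substituting terms for variables. Later uses reorder variables this way, giving the new term for
each index case by case. -/
theorem BddDef.comp {F : (ℕ → M) → ℕ → M} (hP : BddDef S E P)
    (hF : ∀ i, TermDef S fun e => F e i) : BddDef S E fun e => P (F e) := by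
  obtain ⟨φ, hφ, h⟩ := hP
  choose σ hσ using hF
  exact ⟨φ.subst σ, hφ.subst σ, fun e => by simp only [Formula.realize_subst, h, hσ]⟩

/-- A dummy variable may be put in front. -/
theorem BddDef.succ (hP : BddDef S E P) : BddDef S E fun e => P fun i => e (i + 1) :=
  hP.comp fun i => .var (i + 1)

variable [Zero M] [One M] [Add M] [Mul M] [LT M]

theorem TermDef.zero (hI : Interprets S) : TermDef S fun _ => 0 := ⟨.zero, fun _ => hI.zero⟩

theorem TermDef.one (hI : Interprets S) : TermDef S fun _ => 1 := ⟨.one, fun _ => hI.one⟩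

theorem TermDef.add (hI : Interprets S) (hf : TermDef S f) (hg : TermDef S g) :
    TermDef S fun e => f e + g e := by
  obtain ⟨s, hs⟩ := hf
  obtain ⟨t, ht⟩ := hg
  exact ⟨.add s t, fun e => by simp only [Term.eval, hs, ht, hI.add]⟩

theorem TermDef.mul (hI : Interprets S) (hf : TermDef S f) (hg : TermDef S g) :
    TermDef S fun e => f e * g e := by
  obtain ⟨s, hs⟩ := hf
  obtain ⟨t, ht⟩ := hg
  exact ⟨.mul s t, fun e => by simp only [Term.eval, hs, ht, hI.mul]⟩

theorem BddDef.lt (hI : Interprets S) (hf : TermDef S f) (hg : TermDef S g) :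
    BddDef S E fun e => f e < g e := by
  obtain ⟨s, hs⟩ := hf
  obtain ⟨t, ht⟩ := hg
  exact ⟨.lt s t, .lt s t, fun e => by simp only [Formula.Realize, hs, ht, hI.lt]⟩

theorem BddDef.allLt (hI : Interprets S) {R : M → (ℕ → M) → Prop} (hf : TermDef S f)
    (hR : BddDef S E fun e => R (e 0) fun i => e (i + 1)) :
    BddDef S E fun e => ∀ a, a < f e → R a e := by
  obtain ⟨t, ht⟩ := hf
  obtain ⟨φ, hφ, h⟩ := hR
  exact ⟨φ.allLt t, hφ.allLt t, fun e => by
    simp only [Formula.allLt, Formula.Realize, h, Term.eval_shift, ht, hI.lt, Term.eval, push_zero,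
      push_succ]⟩

theorem BddDef.exLt (hI : Interprets S) {R : M → (ℕ → M) → Prop} (hf : TermDef S f)
    (hR : BddDef S E fun e => R (e 0) fun i => e (i + 1)) :
    BddDef S E fun e => ∃ a, a < f e ∧ R a e := by
  obtain ⟨t, ht⟩ := hf
  obtain ⟨φ, hφ, h⟩ := hR
  exact ⟨φ.exLt t, hφ.exLt t, fun e => by
    simp only [Formula.exLt, Formula.Realize, h, Term.eval_shift, ht, hI.lt, Term.eval, push_zero,
      push_succ]⟩

/-! ### Induction and comprehension for definable relations -/

theorem BddDef.induction_ex (hI : Interprets S) (hS : S.Models RCA0) (hP : BddDef S E P) (e : ℕ → M)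
    (zero : ∃ m, P (push m (push 0 e)))
    (succ : ∀ n, (∃ m, P (push m (push n e))) → ∃ m, P (push m (push (n + 1) e))) (n : M) :
    ∃ m, P (push m (push n e)) := by
  obtain ⟨θ, hθ, h⟩ := hP
  have := (satisfies_inductionAxiom S θ.ex).1 (hS _ (.inl (.inr ⟨_, ⟨θ, hθ, rfl⟩, rfl⟩))) e E
  simp only [Formula.Realize, h, hI.zero, hI.add, hI.one] at this
  exact this zero succ n

theorem BddDef.induction (hI : Interprets S) (hS : S.Models RCA0) (hP : BddDef S E P) (e : ℕ → M)
    (zero : P (push 0 e)) (succ : ∀ n, P (push n e) → P (push (n + 1) e)) (n : M) :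
    P (push n e) := by
  -- A vacuous existential quantifier makes the bounded formula `Σ⁰₁`.
  have := hP.succ.induction_ex hI hS e
  simp only [push_succ, exists_const_iff] at this
  exact (this ⟨⟨0⟩, zero⟩ (fun n h => ⟨⟨0⟩, succ n h.2⟩) n).2

theorem BddDef.induction_ex_all (hI : Interprets S) (hS : S.Models ISigma2) (hP : BddDef S E P)
    (e : ℕ → M) (zero : ∃ m, ∀ l, P (push l (push m (push 0 e))))
    (succ : ∀ n, (∃ m, ∀ l, P (push l (push m (push n e)))) →
      ∃ m, ∀ l, P (push l (push m (push (n + 1) e)))) (n : M) :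
    ∃ m, ∀ l, P (push l (push m (push n e))) := by
  obtain ⟨θ, hθ, h⟩ := hP
  have := (satisfies_inductionAxiom S θ.all.ex).1 (hS _ ⟨_, ⟨θ, hθ, rfl⟩, rfl⟩) e E
  simp only [Formula.Realize, h, hI.zero, hI.add, hI.one] at this
  exact this zero succ n

omit [Zero M] [One M] [Add M] [Mul M] [LT M] in
theorem BddDef.comprehension (hS : S.Models RCA0) (hP : BddDef S E P) (e : ℕ → M) :
    {n | P (push n e)} ∈ S.sets := by
  -- With a dummy variable in front, `∃ m θ` and `∀ m θ` are equivalent, so the relation is `Δ⁰₁`.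
  obtain ⟨θ, hθ, h⟩ := hP.succ
  obtain ⟨X, hX, hXn⟩ := (satisfies_comprehensionAxiom S θ.ex θ.all).1
    (hS _ (.inr ⟨_, _, ⟨θ, hθ, rfl⟩, ⟨θ, hθ, rfl⟩, rfl⟩)) e E
    (fun n => by simp only [Formula.Realize, h, push_succ]; exact
      ⟨fun ⟨_, h⟩ _ => h, fun h => ⟨n, h n⟩⟩)
  convert hX
  ext n
  simp only [Set.mem_ofPred_eq, hXn, Formula.Realize, h, push_succ]
  exact ⟨fun h => ⟨n, h⟩, fun ⟨_, h⟩ => h⟩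

end Definability

/-! ### The ordered semiring of numbers -/

section Arithmetic

variable {S : L2Structure M} [Zero M] [One M] [Add M] [Mul M] [LT M]

/-- The basic axioms, in the ambient notation. -/
structure BasicArith (M : Type*) [Zero M] [One M] [Add M] [Mul M] [LT M] : Prop where
  succ_ne_zero : ∀ n : M, n + 1 ≠ 0
  succ_inj : ∀ m n : M, m + 1 = n + 1 → m = n
  add_zero : ∀ m : M, m + 0 = m
  add_succ : ∀ m n : M, m + (n + 1) = m + n + 1
  mul_zero : ∀ m : M, m * 0 = 0
  mul_succ : ∀ m n : M, m * (n + 1) = m * n + m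
  not_lt_zero : ∀ m : M, ¬ m < 0
  lt_succ : ∀ m n : M, m < n + 1 ↔ m < n ∨ m = n

theorem basicArith (hI : Interprets S) (hS : S.Models RCA0) : BasicArith M := by
  obtain ⟨X, hX⟩ := S.sets_nonempty
  have key : ∀ φ ∈ basicAxioms, ∀ m n : M,
      φ.Realize S (push m fun _ => n) fun _ => ⟨X, hX⟩ :=
    fun φ h m n => hS φ (.inl (.inl h)) _ _
  simp only [basicAxioms, Set.mem_insert_iff, Set.mem_singleton_iff, forall_eq_or_imp, forall_eq,
    Formula.Realize, Formula.realize_iff, Term.eval, push_zero, push_one, hI.zero, hI.one, hI.add,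
    hI.mul, hI.lt] at key
  obtain ⟨h1, h2, h3, h4, h5, h6, h7, h8⟩ := key
  exact ⟨fun n => h1 n n, h2, fun m => h3 m m, h4, fun m => h5 m m, h6, fun m => h7 m m, h8⟩

/-! ### Semiring and order laws by induction -/

namespace BasicArith

variable (hI : Interprets S) (hS : S.Models RCA0) (h : BasicArith M)
include hI hS h

omit h in
/-- Induction for equations between terms. -/
theorem eq_induction {f g : (ℕ → M) → M} (hf : TermDef S f) (hg : TermDef S g) (e : ℕ → M)
    (zero : f (push 0 e) = g (push 0 e))
    (succ : ∀ n, f (push n e) = g (push n e) → f (push (n + 1) e) = g (push (n + 1) e)) (n : M) :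
    f (push n e) = g (push n e) := by
  obtain ⟨X, hX⟩ := S.sets_nonempty
  exact (BddDef.eq (E := fun _ => ⟨X, hX⟩) hf hg).induction hI hS e zero succ n

theorem zero_add (n : M) : 0 + n = n :=
  eq_induction hI hS (.add hI (.zero hI) (.var 0)) (.var 0) (fun _ => 0) (h.add_zero 0)
    (fun n ih => by simp only [push_zero] at ih ⊢; rw [h.add_succ, ih]) n

theorem succ_add (m n : M) : m + 1 + n = m + n + 1 :=
  eq_induction hI hS (.add hI (.add hI (.var 1) (.one hI)) (.var 0))
    (.add hI (.add hI (.var 1) (.var 0)) (.one hI)) (fun _ => m)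
    (by simp only [push_zero, push_one, h.add_zero])
    (fun n ih => by simp only [push_zero, push_one] at ih ⊢; rw [h.add_succ, ih, h.add_succ]) n

theorem add_comm (m n : M) : m + n = n + m :=
  eq_induction hI hS (.add hI (.var 1) (.var 0)) (.add hI (.var 0) (.var 1)) (fun _ => m)
    (by simp only [push_zero, push_one, h.add_zero, zero_add hI hS h])
    (fun n ih => by
      simp only [push_zero, push_one] at ih ⊢; rw [h.add_succ, ih, succ_add hI hS h]) n

theorem add_assoc (k m n : M) : k + m + n = k + (m + n) :=
  eq_induction hI hS (.add hI (.add hI (.var 1) (.var 2)) (.var 0))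
    (.add hI (.var 1) (.add hI (.var 2) (.var 0))) (push k fun _ => m)
    (by simp only [push_zero, push_one, push_two, h.add_zero])
    (fun n ih => by
      simp only [push_zero, push_one, push_two] at ih ⊢; rw [h.add_succ, ih, h.add_succ, h.add_succ])
    n

theorem add_right_cancel (a b c : M) (hab : a + c = b + c) : a = b := by
  obtain ⟨X, hX⟩ := S.sets_nonempty
  refine (BddDef.imp (E := fun _ => ⟨X, hX⟩) (BddDef.eq (.add hI (.var 1) (.var 0))
    (.add hI (.var 2) (.var 0))) (BddDef.eq (.var 1) (.var 2))).induction hI hS (push a fun _ => b)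
    ?_ ?_ c hab
  · simp only [push_zero, push_one, push_two, h.add_zero, imp_self]
  · intro n ih
    simp only [push_zero, push_one, push_two, h.add_succ] at ih ⊢
    exact fun H => ih (h.succ_inj _ _ H)

theorem zero_mul (n : M) : 0 * n = 0 :=
  eq_induction hI hS (.mul hI (.zero hI) (.var 0)) (.zero hI) (fun _ => 0) (h.mul_zero 0)
    (fun n ih => by simp only [push_zero] at ih ⊢; rw [h.mul_succ, ih, h.add_zero]) n

theorem succ_mul (m n : M) : (m + 1) * n = m * n + n :=
  eq_induction hI hS (.mul hI (.add hI (.var 1) (.one hI)) (.var 0))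
    (.add hI (.mul hI (.var 1) (.var 0)) (.var 0)) (fun _ => m)
    (by simp only [push_zero, push_one, h.add_zero, h.mul_zero])
    (fun n ih => by
      simp only [push_zero, push_one] at ih ⊢
      rw [h.mul_succ, ih, h.mul_succ, h.add_succ, h.add_succ,
        add_assoc hI hS h _ n m, add_comm hI hS h n m, add_assoc hI hS h _ m n]) n

theorem mul_comm (m n : M) : m * n = n * m :=
  eq_induction hI hS (.mul hI (.var 1) (.var 0)) (.mul hI (.var 0) (.var 1)) (fun _ => m)
    (by simp only [push_zero, push_one, h.mul_zero, zero_mul hI hS h])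
    (fun n ih => by
      simp only [push_zero, push_one] at ih ⊢; rw [h.mul_succ, ih, succ_mul hI hS h]) n

theorem mul_add (k m n : M) : k * (m + n) = k * m + k * n :=
  eq_induction hI hS (.mul hI (.var 1) (.add hI (.var 2) (.var 0)))
    (.add hI (.mul hI (.var 1) (.var 2)) (.mul hI (.var 1) (.var 0))) (push k fun _ => m)
    (by simp only [push_zero, push_one, push_two, h.add_zero, h.mul_zero])
    (fun n ih => by
      simp only [push_zero, push_one, push_two] at ih ⊢
      rw [h.add_succ, h.mul_succ, h.mul_succ, ih, add_assoc hI hS h]) n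

theorem mul_assoc (k m n : M) : k * m * n = k * (m * n) :=
  eq_induction hI hS (.mul hI (.mul hI (.var 1) (.var 2)) (.var 0))
    (.mul hI (.var 1) (.mul hI (.var 2) (.var 0))) (push k fun _ => m)
    (by simp only [push_zero, push_one, push_two, h.mul_zero])
    (fun n ih => by
      simp only [push_zero, push_one, push_two] at ih ⊢
      rw [h.mul_succ, h.mul_succ, mul_add hI hS h, ih]) n

theorem mul_one (n : M) : n * 1 = n := by
  rw [← zero_add hI hS h 1, h.mul_succ, h.mul_zero, zero_add hI hS h]

omit h in
theorem eq_zero_or_succ (n : M) : n = 0 ∨ ∃ m, n = m + 1 := by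
  obtain ⟨X, hX⟩ := S.sets_nonempty
  obtain ⟨m, hm⟩ := (BddDef.or (E := fun _ => ⟨X, hX⟩) (.eq (.var 1) (.zero hI))
    (.eq (.var 1) (.add hI (.var 0) (.one hI)))).induction_ex hI hS (fun _ => 0) ⟨0, .inl rfl⟩
    (fun n _ => ⟨n, .inr rfl⟩) n
  exact hm.imp id fun hm => ⟨m, hm⟩

/-- `Σ⁰₁` induction on `a`, with one `d` quantified outside the disjunction: the difference
decreases until `a = b`, then grows on the other side. -/
theorem exists_add_eq_total (a b : M) : (∃ d, a + d = b) ∨ ∃ d, b + d = a := by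
  obtain ⟨X, hX⟩ := S.sets_nonempty
  obtain ⟨m, hm⟩ := (BddDef.or (E := fun _ => ⟨X, hX⟩)
    (.eq (.add hI (.var 1) (.var 0)) (.var 2))
    (.eq (.add hI (.var 2) (.var 0)) (.var 1))).induction_ex hI hS (fun _ => b)
    ⟨b, .inl (zero_add hI hS h b)⟩ (by
      simp only [push_zero, push_one, push_two]
      rintro n ⟨d, hd | hd⟩
      · rcases eq_zero_or_succ hI hS d with rfl | ⟨d, rfl⟩
        · exact ⟨1, .inr (by rw [← hd, h.add_zero])⟩
        · exact ⟨d, .inl (by rw [← hd, succ_add hI hS h, h.add_succ])⟩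
      · exact ⟨d + 1, .inr (by rw [h.add_succ, hd])⟩) a
  exact hm.imp (fun hm => ⟨m, hm⟩) fun hm => ⟨m, hm⟩

/-- The axioms tie `<` to addition only through successors, so each direction is an induction. In
the forward one `∃ d` stands outside the implication, which keeps the formula `Σ⁰₁`. -/
theorem lt_iff (a b : M) : a < b ↔ ∃ d, a + (d + 1) = b := by
  obtain ⟨X, hX⟩ := S.sets_nonempty
  constructor
  · refine fun hab => ((BddDef.imp (E := fun _ => ⟨X, hX⟩) (.lt hI (.var 2) (.var 1))
      (.eq (.add hI (.var 2) (.add hI (.var 0) (.one hI))) (.var 1))).induction_ex hI hS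
      (fun _ => a) ⟨0, fun H => (h.not_lt_zero _ H).elim⟩ ?_ b).imp fun d hd => hd hab
    simp only [push_zero, push_one, push_two]
    rintro n ⟨d, hd⟩
    by_cases han : a < n
    · exact ⟨d + 1, fun _ => by rw [h.add_succ, hd han]⟩
    · exact ⟨0, fun H => by
        rw [((h.lt_succ _ _).1 H).resolve_left han, zero_add hI hS h]⟩
  · rintro ⟨d, rfl⟩
    refine (BddDef.lt (E := fun _ => ⟨X, hX⟩) hI (.var 1)
      (.add hI (.var 1) (.add hI (.var 0) (.one hI)))).induction hI hS (fun _ => a) ?_ ?_ d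
    · simp only [push_zero, push_one, zero_add hI hS h]
      exact (h.lt_succ _ _).2 (.inr rfl)
    · intro n hn
      simp only [push_zero, push_one, h.add_succ] at hn ⊢
      exact (h.lt_succ _ _).2 (.inl hn)

end BasicArith

end Arithmetic

/-- The numbers of a model of `RCA₀` form a discretely ordered commutative semiring. -/
theorem exists_orderedSemiring (S : L2Structure M) (hS : S.Models RCA0) :
    ∃ (_ : CommSemiring M) (_ : LinearOrder M), IsStrictOrderedRing M ∧ CanonicallyOrderedAdd M ∧
      Interprets S ∧ ∀ a b : M, a < b + 1 ↔ a ≤ b := by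
  let : Zero M := ⟨S.zero⟩
  let : One M := ⟨S.one⟩
  let : Add M := ⟨S.add⟩
  let : Mul M := ⟨S.mul⟩
  let : LT M := ⟨S.lt⟩
  have hI : Interprets S := ⟨rfl, rfl, fun _ _ => rfl, fun _ _ => rfl, fun _ _ => Iff.rfl⟩
  have h := basicArith hI hS
  have zero_add := BasicArith.zero_add hI hS h
  have add_comm := BasicArith.add_comm hI hS h
  have add_assoc := BasicArith.add_assoc hI hS h
  have mul_comm := BasicArith.mul_comm hI hS h
  have mul_add := BasicArith.mul_add hI hS h
  have mul_one := BasicArith.mul_one hI hS h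
  have cancel := BasicArith.add_right_cancel hI hS h
  have lt_iff := BasicArith.lt_iff hI hS h
  have cases_succ := BasicArith.eq_zero_or_succ hI hS
  let iR : CommSemiring M :=
    { zero_add := zero_add
      add_zero := h.add_zero
      add_comm := add_comm
      add_assoc := add_assoc
      mul_comm := mul_comm
      mul_assoc := BasicArith.mul_assoc hI hS h
      mul_one := mul_one
      one_mul := fun a => by rw [mul_comm, mul_one]
      left_distrib := mul_add
      right_distrib := fun a b c => by rw [mul_comm, mul_add, mul_comm c, mul_comm c]
      zero_mul := BasicArith.zero_mul hI hS h
      mul_zero := h.mul_zero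
      nsmul := nsmulRec }
  have add_eq_zero : ∀ a b : M, a + b = 0 → b = 0 := fun a b hab => by
    rcases cases_succ b with rfl | ⟨c, rfl⟩
    · rfl
    · exact (h.succ_ne_zero (a + c) (by rw [← hab, h.add_succ])).elim
  have self_add : ∀ a b : M, a + b = a → b = 0 := fun a b hab =>
    cancel b 0 a (by rw [add_comm, hab, zero_add])
  let iL : LinearOrder M :=
    -- `≤` is defined by differences while `<` stays the relation of `S`; `lt_iff` reconciles them.
    { le := fun a b => ∃ d, a + d = b
      le_refl := fun a => ⟨0, h.add_zero a⟩
      le_trans := by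
        rintro a _ _ ⟨d, rfl⟩ ⟨d', rfl⟩
        exact ⟨d + d', (add_assoc _ _ _).symm⟩
      le_antisymm := by
        rintro a _ ⟨d, rfl⟩ ⟨d', h'⟩
        have := add_eq_zero d' d (by rw [add_comm]; exact self_add a _ (by rw [← add_assoc, h']))
        rw [this, h.add_zero]
      le_total := BasicArith.exists_add_eq_total hI hS h
      lt := (· < ·)
      lt_iff_le_not_ge := by
        intro a b
        rw [lt_iff]
        constructor
        · rintro ⟨d, rfl⟩
          refine ⟨⟨_, rfl⟩, fun ⟨c, hc⟩ => h.succ_ne_zero d (add_eq_zero c _ ?_)⟩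
          rw [add_comm]
          exact self_add a _ (by rw [← add_assoc, hc])
        · rintro ⟨⟨d, rfl⟩, hd⟩
          rcases cases_succ d with rfl | ⟨d, rfl⟩
          · exact (hd ⟨0, by rw [h.add_zero, h.add_zero]⟩).elim
          · exact ⟨d, rfl⟩
      toDecidableLE := Classical.decRel _ }
  have hC : CanonicallyOrderedAdd M :=
    { exists_add_of_le := fun ⟨d, hd⟩ => ⟨d, hd.symm⟩
      le_self_add := fun a b => ⟨b, rfl⟩
      le_add_self := fun a b => ⟨b, add_comm _ _⟩ }
  have hO : IsOrderedCancelAddMonoid M :=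
    { add_le_add_left := by
        rintro a _ ⟨d, rfl⟩ c
        exact ⟨d, by ring⟩
      le_of_add_le_add_left := by
        rintro a b c ⟨d, hd⟩
        exact ⟨d, cancel _ _ a (by rw [add_comm c a, ← hd]; ring)⟩ }
  have hpos : ∀ a : M, 0 < a → ∃ d, a = d + 1 := fun a ha => by
    obtain ⟨d, hd⟩ := (lt_iff 0 a).1 ha
    exact ⟨d, by rw [← hd, zero_add]⟩
  have hN : Nontrivial M := ⟨⟨0, 1, fun H => h.succ_ne_zero 0 (by rw [zero_add, ← H])⟩⟩
  have hmul : ∀ a b c : M, 0 < a → b < c → a * b < a * c := fun a b c ha hbc => by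
    obtain ⟨d, rfl⟩ := hpos a ha
    obtain ⟨d', rfl⟩ := (lt_iff b c).1 hbc
    exact (lt_iff _ _).2 ⟨d * d' + d + d', by ring⟩
  refine ⟨iR, iL, { hO, hN with
    zero_le_one := ⟨1, zero_add 1⟩
    mul_lt_mul_of_pos_left := fun a ha b c hbc => hmul a b c ha hbc
    mul_lt_mul_of_pos_right := fun a ha b c hbc => by
      rw [mul_comm b, mul_comm c]; exact hmul a b c ha hbc }, hC, hI, fun a b => ?_⟩
  rw [le_iff_lt_or_eq]
  exact h.lt_succ a b

/-! ### Pairs, divisibility and least elements -/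

section Ordered

set_option linter.unusedSectionVars false

variable [CommSemiring M] [LinearOrder M] [IsStrictOrderedRing M] [CanonicallyOrderedAdd M]

/-- The code of the pair `(x, y)`. -/
def code (x y : M) : M := (x + y) * (x + y) + x

theorem Interprets.pair {S : L2Structure M} (hI : Interprets S) (x y : M) :
    S.pair x y = code x y := by
  simp only [L2Structure.pair, code, hI.add, hI.mul]

theorem one_le_of_pos (hM : ∀ a b : M, a < b + 1 ↔ a ≤ b) {a : M} (ha : 0 < a) : 1 ≤ a :=
  le_of_not_gt fun h => ha.not_ge ((hM a 0).1 (by rwa [zero_add]))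

theorem le_mul_self_of_discrete (hM : ∀ a b : M, a < b + 1 ↔ a ≤ b) (a : M) : a ≤ a * a := by
  rcases eq_or_ne a 0 with rfl | ha
  · exact zero_le
  · have h1 := one_le_of_pos hM (pos_iff_ne_zero.2 ha)
    exact le_mul_of_one_le_left (zero_le) h1

theorem left_le_code (x y : M) : x ≤ code x y := le_add_self

theorem right_le_code (hM : ∀ a b : M, a < b + 1 ↔ a ≤ b) (x y : M) : y ≤ code x y :=
  le_trans le_add_self ((le_mul_self_of_discrete hM (x + y)).trans le_self_add)

theorem code_le_code {x y x' y' : M} (hx : x ≤ x') (hy : y ≤ y') : code x y ≤ code x' y' := by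
  unfold code
  gcongr

/-- With `s = x + y`, the code lies between `s²` and `s² + s < (s + 1)²`. -/
theorem code_lt_code_of_add_lt {x y x' y' : M} (hM : ∀ a b : M, a < b + 1 ↔ a ≤ b)
    (h : x + y < x' + y') : code x y < code x' y' := by
  have h1 : x + y + 1 ≤ x' + y' := le_of_not_gt fun H => ((hM _ _).1 H).not_gt h
  calc code x y ≤ (x + y) * (x + y) + (x + y) := by
        unfold code
        gcongr
        exact le_self_add
    _ < (x + y) * (x + y) + (x + y) + (x + y + 1) :=
        lt_add_of_pos_right _ (lt_of_lt_of_le one_pos le_add_self)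
    _ = (x + y + 1) * (x + y + 1) := by ring
    _ ≤ (x' + y') * (x' + y') := by gcongr
    _ ≤ code x' y' := le_self_add

theorem code_inj (hM : ∀ a b : M, a < b + 1 ↔ a ≤ b) {x y x' y' : M} :
    code x y = code x' y' ↔ x = x' ∧ y = y' := by
  refine ⟨fun h => ?_, fun ⟨h, h'⟩ => by rw [h, h']⟩
  rcases lt_trichotomy (x + y) (x' + y') with hs | hs | hs
  · exact absurd h (code_lt_code_of_add_lt hM hs).ne
  · have hx : x = x' := by
      unfold code at h
      rw [hs] at h
      exact add_left_cancel h
    subst hx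
    exact ⟨rfl, add_left_cancel hs⟩
  · exact absurd h (code_lt_code_of_add_lt hM hs).ne'

/-- There is no subtraction, so the quotients are compared; if that of `b + c` is not the larger
one, then `c = 0`. -/
theorem dvd_of_dvd_add {a b c : M} (h : a ∣ b) (h' : a ∣ b + c) : a ∣ c := by
  obtain ⟨p, rfl⟩ := h
  obtain ⟨q, hq⟩ := h'
  rcases le_total p q with hpq | hpq
  · obtain ⟨r, rfl⟩ := exists_add_of_le hpq
    exact ⟨r, add_left_cancel (hq.trans (mul_add a p r))⟩
  · have : a * p + c ≤ a * p + 0 := by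
      rw [hq, add_zero]
      gcongr
    rw [nonpos_iff_eq_zero.1 (le_of_add_le_add_left this)]
    exact dvd_zero a

/-- Bounding the quotient makes divisibility a bounded formula; for `a = 0` the quotient is chosen
to be `0`. -/
theorem dvd_iff_exists_lt (hM : ∀ a b : M, a < b + 1 ↔ a ≤ b) (a b : M) :
    a ∣ b ↔ ∃ q, q < b + 1 ∧ b = a * q := by
  refine ⟨?_, fun ⟨q, _, h⟩ => ⟨q, h⟩⟩
  rintro ⟨q, rfl⟩
  rcases eq_or_ne a 0 with rfl | ha
  · exact ⟨0, (hM _ _).2 (zero_le), by simp⟩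
  · have h1 := one_le_of_pos hM (pos_iff_ne_zero.2 ha)
    exact ⟨q, (hM _ _).2 (le_mul_of_one_le_left (zero_le) h1), rfl⟩

theorem exists_eq_succ_of_pos (hM : ∀ a b : M, a < b + 1 ↔ a ≤ b) {a : M} (ha : 0 < a) :
    ∃ b, a = b + 1 := by
  obtain ⟨b, rfl⟩ := exists_add_of_le (one_le_of_pos hM ha)
  exact ⟨b, add_comm _ _⟩

/-- If `m` is divisible by `1, …, k`, then the numbers `(i + 1) m + 1`, `i < k`, are pairwise
coprime. -/
theorem dvd_of_dvd_mul_moduli (hM : ∀ a b : M, a < b + 1 ↔ a ≤ b) {k m i j t : M}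
    (hm : ∀ i < k, i + 1 ∣ m) (hi : i < k) (hj : j < k) (hij : i ≠ j)
    (h : (j + 1) * m + 1 ∣ ((i + 1) * m + 1) * t) : (j + 1) * m + 1 ∣ t := by
  -- Here `r + 1 = |i - j|`: multiplying the moduli of `i` and `j` by `j + 1` and `i + 1` gives
  -- numbers that differ by `|i - j|`.
  obtain ⟨r, hr, hdvd⟩ : ∃ r, r + 1 ∣ m ∧ (j + 1) * m + 1 ∣ (r + 1) * t := by
    rcases lt_or_gt_of_ne hij with hlt | hlt
    · obtain ⟨s, rfl⟩ := exists_add_of_le hlt.le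
      obtain ⟨r, rfl⟩ := exists_eq_succ_of_pos hM (pos_of_lt_add_right hlt)
      refine ⟨r, hm r (lt_of_le_of_lt ?_ hj), dvd_of_dvd_add (Dvd.intro_left ((i + 1) * t) rfl) ?_⟩
      · exact le_self_add.trans le_add_self
      · refine (h.mul_left (i + (r + 1) + 1)).trans (dvd_of_eq ?_)
        ring
    · obtain ⟨s, rfl⟩ := exists_add_of_le hlt.le
      obtain ⟨r, rfl⟩ := exists_eq_succ_of_pos hM (pos_of_lt_add_right hlt)
      refine ⟨r, hm r (lt_of_le_of_lt ?_ hi), dvd_of_dvd_add (h.mul_left (j + 1)) ?_⟩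
      · exact le_self_add.trans le_add_self
      · refine Dvd.intro_left ((j + (r + 1) + 1) * t) ?_
        ring
  obtain ⟨q, rfl⟩ := hr
  -- As `r + 1` divides `m`, the modulus of `j` divides `(j + 1) m t`, which falls short of its own
  -- multiple `((j + 1) m + 1) t` by `t`.
  refine dvd_of_dvd_add (hdvd.mul_left ((j + 1) * q)) (Dvd.intro_left t ?_)
  ring

section Definability

variable {S : L2Structure M} {E : ℕ → S.sets} {f g : (ℕ → M) → M} {P Q : (ℕ → M) → Prop}

theorem TermDef.code (hI : Interprets S) (hf : TermDef S f) (hg : TermDef S g) :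
    TermDef S fun e => code (f e) (g e) :=
  .add hI (.mul hI (.add hI hf hg) (.add hI hf hg)) hf

theorem TermDef.add_one (hI : Interprets S) (hf : TermDef S f) : TermDef S fun e => f e + 1 :=
  .add hI hf (.one hI)

theorem BddDef.dvd (hI : Interprets S) (hM : ∀ a b : M, a < b + 1 ↔ a ≤ b)
    (hf : TermDef S f) (hg : TermDef S g) : BddDef S E fun e => f e ∣ g e := by
  have h : BddDef S E fun e => ∃ q, q < e 1 + 1 ∧ e 1 = e 0 * q :=
    .exLt hI (.add_one hI (.var 1)) (.eq (.var 2) (.mul hI (.var 1) (.var 0)))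
  have := h.comp (F := fun e => push (f e) fun _ => g e) fun i => by
    rcases i with _ | i
    exacts [hf, hg]
  simpa only [dvd_iff_exists_lt hM, push_zero, push_one] using this

/-- The least element principle for bounded quantifier formulas. -/
theorem BddDef.exists_least (hI : Interprets S) (hM : ∀ a b : M, a < b + 1 ↔ a ≤ b)
    (hS : S.Models RCA0) (hP : BddDef S E P) (e : ℕ → M) {n : M} (hn : P (push n e)) :
    ∃ a, P (push a e) ∧ ∀ b < a, ¬ P (push b e) := by
  by_contra! H
  have hQ : BddDef S E fun v => ∀ a, a < v 0 → ¬ P (push a fun i => v (i + 1)) :=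
    .allLt hI (.var 0) <| .not <| hP.comp fun i => by
      rcases i with _ | i
      exacts [.var 0, .var (i + 2)]
  refine hQ.induction hI hS e (fun a ha => (not_lt_zero ha).elim) (fun n ih a ha hPa => ?_) (n + 1)
    n ((hM _ _).2 le_rfl) hn
  obtain ⟨b, hb, hPb⟩ := H a hPa
  exact ih b (hb.trans_le ((hM _ _).1 ha)) hPb

/-- The least element principle for `Σ⁰₂` formulas. -/
theorem BddDef.exists_least_ex_all (hI : Interprets S) (hM : ∀ a b : M, a < b + 1 ↔ a ≤ b)
    (hS : S.Models ISigma2) (hP : BddDef S E P) (e : ℕ → M) {T : M}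
    (hT : ∃ b, ∀ l, P (push l (push b (push T e)))) :
    ∃ t, (∃ b, ∀ l, P (push l (push b (push t e)))) ∧
      ∀ s < t, ¬ ∃ b, ∀ l, P (push l (push b (push s e))) := by
  by_contra! H
  -- Without a least element, induction on `n` yields solutions `t` with `t + n ≤ T`, absurd at `n =
  -- T + 1`. Coding `t` and `b` in one number `w` leaves a single unbounded `∃` before `∀ l`.
  have hQ : BddDef S E fun v => ∃ t, t < v 1 + 1 ∧ ∃ b, b < v 1 + 1 ∧ v 1 = SOA.code t b ∧
      t + v 2 < v 3 + 1 ∧ P (push (v 0) (push b (push t fun i => v (i + 4)))) :=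
    .exLt hI (.add_one hI (.var 1)) <| .exLt hI (.add_one hI (.var 2)) <|
      .and (.eq (.var 3) (.code hI (.var 1) (.var 0))) <|
      .and (.lt hI (.add hI (.var 1) (.var 4)) (.add_one hI (.var 5))) <| hP.comp fun i => by
        rcases i with _ | _ | _ | i
        exacts [.var 2, .var 0, .var 1, .var (i + 6)]
  have key : ∀ n, (∃ w, ∀ l, ∃ t, t < w + 1 ∧ ∃ b, b < w + 1 ∧ w = SOA.code t b ∧
      t + n < T + 1 ∧ P (push l (push b (push t e)))) ↔
      ∃ t, t + n ≤ T ∧ ∃ b, ∀ l, P (push l (push b (push t e))) := by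
    intro n
    constructor
    · rintro ⟨w, hw⟩
      -- Any instance of `l` decodes `w`; injectivity of the code gives the same pair for all `l`.
      obtain ⟨t, -, b, -, rfl, ht, -⟩ := hw 0
      refine ⟨t, (hM _ _).1 ht, b, fun l => ?_⟩
      obtain ⟨t', -, b', -, h, -, h'⟩ := hw l
      obtain ⟨rfl, rfl⟩ := (code_inj hM).1 h
      exact h'
    · rintro ⟨t, ht, b, h⟩
      exact ⟨SOA.code t b, fun l => ⟨t, (hM _ _).2 (left_le_code _ _), b,
        (hM _ _).2 (right_le_code hM _ _), rfl, (hM _ _).2 ht, h l⟩⟩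
  have main := hQ.induction_ex_all hI hS (push T e) ((key 0).2 ⟨T, (add_zero T).le, hT⟩)
    (fun n ih => (key (n + 1)).2 <| by
      obtain ⟨t, ht, h⟩ := (key n).1 ih
      obtain ⟨s, hs, h'⟩ := H t h
      refine ⟨s, le_of_not_gt fun hlt => ?_, h'⟩
      have := ht.trans_lt hlt
      rw [← add_assoc, hM] at this
      exact (lt_of_add_lt_add_right (this.trans_lt (add_lt_add_left hs n))).false) (T + 1)
  obtain ⟨t, ht, -⟩ := (key (T + 1)).1 main
  exact (((hM T T).2 le_rfl).trans_le (le_add_self.trans ht)).false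

/-- Products of internally finite length come from `Σ⁰₁` induction, one factor at a time. The form
`(i + 1) m + c` covers both the multiple of `1, …, k` and the product of the moduli. -/
theorem exists_common_multiple (hI : Interprets S) (hM : ∀ a b : M, a < b + 1 ↔ a ≤ b)
    (hS : S.Models RCA0) (m c : M) (hpos : ∀ i : M, 0 < (i + 1) * m + c) (k : M) :
    ∃ T, 0 < T ∧ ∀ i < k, (i + 1) * m + c ∣ T := by
  obtain ⟨X, hX⟩ := S.sets_nonempty
  have hQ : BddDef S (fun _ => ⟨X, hX⟩) fun v => 0 < v 0 ∧ ∀ i, i < v 1 →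
      (i + 1) * v 2 + v 3 ∣ v 0 :=
    .and (.lt hI (.zero hI) (.var 0)) <| .allLt hI (.var 1) <|
      .dvd hI hM (.add hI (.mul hI (.add_one hI (.var 0)) (.var 3)) (.var 4)) (.var 1)
  refine hQ.induction_ex hI hS (push m fun _ => c) ⟨1, one_pos, fun i hi => (not_lt_zero hi).elim⟩
    (fun n ih => ?_) k
  obtain ⟨T, hT, h⟩ := ih
  refine ⟨T * ((n + 1) * m + c), mul_pos hT (hpos n), fun i hi => ?_⟩
  rcases ((hM _ _).1 hi).lt_or_eq with hi | rfl
  · exact (h i hi).mul_right _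
  · exact Dvd.intro_left _ rfl

/-! ### From `Σ⁰₂` induction to the strong pigeonhole principle -/

theorem exists_infinitely_often_set (hI : Interprets S) (hM : ∀ a b : M, a < b + 1 ↔ a ≤ b)
    (hS : S.Models RCA0) (hS2 : S.Models ISigma2) (k : M) {C : Set M} (hC : C ∈ S.sets) :
    ∃ I ∈ S.sets, ∀ i, i ∈ I ↔ i < k ∧ ∀ y, ∃ x, y < x ∧ SOA.code x i ∈ C := by
  obtain ⟨m, hm0, hm⟩ := exists_common_multiple hI hM hS 1 0
    (fun i => by simp) k
  simp only [mul_one, add_zero] at hm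
  obtain ⟨T, hT0, hT⟩ := exists_common_multiple hI hM hS m 1
    (fun i => lt_of_lt_of_le one_pos le_add_self) k
  -- Variables `0` to `4` are `l`, `b`, `t`, `k`, `m`. Positivity excludes `t = 0`, which every
  -- modulus divides.
  have hQ : BddDef S (fun _ => ⟨C, hC⟩) fun v => 0 < v 2 ∧ ∀ i, i < v 3 →
      (v 1 < v 0 → ¬ SOA.code (v 0) i ∈ C) ∨ (i + 1) * v 4 + 1 ∣ v 2 :=
    .and (.lt hI (.zero hI) (.var 2)) <| .allLt hI (.var 3) <|
      .or (.imp (.lt hI (.var 2) (.var 1)) (.not (.mem 0 (.code hI (.var 1) (.var 0))))) <|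
      .dvd hI hM (.add_one hI (.mul hI (.add_one hI (.var 0)) (.var 5))) (.var 3)
  obtain ⟨t, ⟨b, ht⟩, hmin⟩ := hQ.exists_least_ex_all hI hM hS2 (push k fun _ => m) (T := T)
    ⟨0, fun l => ⟨hT0, fun i hi => .inr (hT i hi)⟩⟩
  simp only [push_zero, push_one, push_two, push_three,
    show ∀ (a : M) e, push a e 4 = e 3 from fun _ _ => rfl] at ht hmin
  have hJ : BddDef S (fun _ => ⟨C, hC⟩) fun v => v 0 < v 1 ∧ (v 0 + 1) * v 2 + 1 ∣ v 3 :=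
    .and (.lt hI (.var 0) (.var 1)) <|
      .dvd hI hM (.add_one hI (.mul hI (.add_one hI (.var 0)) (.var 2))) (.var 3)
  refine ⟨_, hJ.comprehension hS (push k (push m fun _ => t)), fun i => ?_⟩
  simp only [Set.mem_ofPred_eq, push_zero, push_one, push_two, push_three]
  refine and_congr_right fun hi => ⟨?_, fun h => ?_⟩
  · rintro ⟨t', rfl⟩
    by_contra! H
    obtain ⟨y, hy⟩ := H
    have ht' : 0 < t' := pos_of_mul_pos_right (ht 0).1 (zero_le)
    -- The quotient `t'` drops color `i`, which is absent beyond `y`, and so contradicts minimality.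
    refine hmin t' ?_ ⟨max b y, fun l => ⟨ht', fun j hj => ?_⟩⟩
    · rw [add_mul, one_mul]
      exact lt_add_of_pos_left _ (mul_pos (mul_pos (lt_of_lt_of_le one_pos le_add_self) hm0) ht')
    · rcases eq_or_ne i j with rfl | hij
      · exact .inl fun hl => hy l ((le_max_right _ _).trans_lt hl)
      · exact ((ht l).2 j hj).imp (fun h hl => h ((le_max_left _ _).trans_lt hl))
          (dvd_of_dvd_mul_moduli hM hm hi hj hij)
  · obtain ⟨x, hx, hxC⟩ := h b
    exact ((ht x).2 i hi).resolve_left fun h => h hx hxC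

end Definability

/-! ### From the strong pigeonhole principle to `Σ⁰₂` induction -/

/-- All `a < b` have a witness `m < d` to the failure of the relation `P` of `m, a, i, e`. -/
def FailsBelow (P : (ℕ → M) → Prop) (e : ℕ → M) (i b d : M) : Prop :=
  ∀ a, a < b → ∃ m, m < d ∧ ¬ P (push m (push a (push i e)))

/-- `x` codes a triple `(i, b, d)` with `i < k` and `d` least such that `FailsBelow P e i b d`. -/
def IsStage (P : (ℕ → M) → Prop) (k : M) (e : ℕ → M) (x i : M) : Prop :=
  i < k ∧ ∃ b, b < x + 1 ∧ ∃ d, d < x + 1 ∧ x = code i (code b d) ∧ FailsBelow P e i b d ∧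
    ∀ c, c < d → ¬ FailsBelow P e i b c

theorem FailsBelow.mono {P : (ℕ → M) → Prop} {e : ℕ → M} {i b b' d d' : M}
    (h : FailsBelow P e i b d) (hb : b' ≤ b) (hd : d ≤ d') : FailsBelow P e i b' d' :=
  fun a ha => (h a (ha.trans_le hb)).imp fun _ hm => ⟨hm.1.trans_le hd, hm.2⟩

/-! ### Stages and the coloring they define -/

section

variable {S : L2Structure M} {E : ℕ → S.sets} {P : (ℕ → M) → Prop}
  (hI : Interprets S) (hM : ∀ a b : M, a < b + 1 ↔ a ≤ b) (hS : S.Models RCA0)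
  (hP : BddDef S E P)

include hI hP in
theorem BddDef.failsBelow {i b d : (ℕ → M) → M} {F : (ℕ → M) → ℕ → M} (hi : TermDef S i)
    (hb : TermDef S b) (hd : TermDef S d) (hF : ∀ j, TermDef S fun v => F v j) :
    BddDef S E fun v => FailsBelow P (F v) (i v) (b v) (d v) := by
  have h : BddDef S E fun v => FailsBelow P (fun j => v (j + 3)) (v 0) (v 1) (v 2) :=
    .allLt hI (.var 1) <| .exLt hI (.var 3) <| .not <| hP.comp fun j => by
      rcases j with _ | _ | _ | j
      exacts [.var 0, .var 1, .var 2, .var (j + 5)]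
  exact h.comp (F := fun v => push (i v) (push (b v) (push (d v) (F v)))) fun j => by
    rcases j with _ | _ | _ | j
    exacts [hi, hb, hd, hF j]

include hI hP in
theorem BddDef.isStage {k x i : (ℕ → M) → M} {F : (ℕ → M) → ℕ → M} (hk : TermDef S k)
    (hx : TermDef S x) (hi : TermDef S i) (hF : ∀ j, TermDef S fun v => F v j) :
    BddDef S E fun v => IsStage P (k v) (F v) (x v) (i v) := by
  have h : BddDef S E fun v => IsStage P (v 0) (fun j => v (j + 3)) (v 1) (v 2) :=
    .and (.lt hI (.var 2) (.var 0)) <| .exLt hI (.add_one hI (.var 1)) <|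
    .exLt hI (.add_one hI (.var 2)) <|
    .and (.eq (.var 3) (.code hI (.var 4) (.code hI (.var 1) (.var 0)))) <|
    .and (hP.failsBelow hI (.var 4) (.var 1) (.var 0) fun j => .var (j + 5)) <|
    .allLt hI (.var 0) <| .not <|
      hP.failsBelow hI (.var 5) (.var 2) (.var 0) fun j => .var (j + 6)
  exact h.comp (F := fun v => push (k v) (push (x v) (push (i v) (F v)))) fun j => by
    rcases j with _ | _ | _ | j
    exacts [hk, hx, hi, hF j]

include hI hS hP in
/-- Bounding: either all bounds are reached, or there is a least bound that is not. -/
theorem BddDef.failsBelow_dichotomy (e : ℕ → M) (i : M) :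
    (∀ b, ∃ d, FailsBelow P e i b d) ∨
      ∃ b d, FailsBelow P e i b d ∧ ∀ d', ¬ FailsBelow P e i (b + 1) d' := by
  by_contra! H
  obtain ⟨⟨b, hb⟩, H⟩ := H
  have hD : BddDef S E fun v => FailsBelow P (fun j => v (j + 3)) (v 2) (v 1) (v 0) :=
    hP.failsBelow hI (.var 2) (.var 1) (.var 0) fun j => .var (j + 3)
  -- If no reachable bound were last, `Σ⁰₁` induction would reach every `b`.
  obtain ⟨d, hd⟩ := hD.induction_ex hI hS (push i e) ⟨0, fun a ha => (not_lt_zero ha).elim⟩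
    (fun n ⟨d, hd⟩ => H n d hd) b
  exact hb d hd

include hI hM hS hP in
-- Bounding: a last reachable `b` is impossible, since a single witness for `a = b` extends the
-- common bound to `b + 1`.
theorem BddDef.forall_failsBelow_iff (e : ℕ → M) (i : M) :
    (∀ b, ∃ d, FailsBelow P e i b d) ↔ ∀ b, ∃ m, ¬ P (push m (push b (push i e))) := by
  refine ⟨fun h b => ?_, fun h => ?_⟩
  · obtain ⟨d, hd⟩ := h (b + 1)
    obtain ⟨m, -, hm⟩ := hd b ((hM _ _).2 le_rfl)
    exact ⟨m, hm⟩
  · refine (hP.failsBelow_dichotomy hI hS e i).resolve_right ?_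
    rintro ⟨b, d, hd, hn⟩
    obtain ⟨m, hm⟩ := h b
    refine hn (max d (m + 1)) fun a ha => ?_
    rcases ((hM _ _).1 ha).lt_or_eq with ha | rfl
    · exact hd.mono le_rfl (le_max_left _ _) a ha
    · exact ⟨m, ((hM _ _).2 le_rfl).trans_le (le_max_right _ _), hm⟩

include hI hM hS hP in
-- If `b₀` is the last reachable bound, with common bound `d₀`, every stage of `i` has `b ≤ b₀` and,
-- by leastness, `d ≤ d₀`, so its code is bounded. Otherwise the stage for `b = y + 1` has a code
-- above `y`.
theorem BddDef.infinitely_many_stages_iff (e : ℕ → M) {k i : M} (hi : i < k) :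
    (∀ y, ∃ x, y < x ∧ IsStage P k e x i) ↔ ∀ b, ∃ d, FailsBelow P e i b d := by
  constructor
  · refine fun h => (hP.failsBelow_dichotomy hI hS e i).resolve_right ?_
    rintro ⟨b₀, d₀, h₀, hn⟩
    obtain ⟨x, hx, -, b, -, d, -, rfl, hd, hmin⟩ := h (code i (code b₀ d₀))
    have hb : b ≤ b₀ := le_of_not_gt fun H =>
      hn d (hd.mono (le_of_not_gt fun H' => ((hM _ _).1 H').not_gt H) le_rfl)
    have hd' : d ≤ d₀ := le_of_not_gt fun H => hmin d₀ H (h₀.mono hb le_rfl)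
    exact (code_le_code le_rfl (code_le_code hb hd')).not_gt hx
  · intro h y
    obtain ⟨d, hd⟩ := h (y + 1)
    have hD : BddDef S E fun v => FailsBelow P (fun j => v (j + 3)) (v 2) (v 1) (v 0) :=
      hP.failsBelow hI (.var 2) (.var 1) (.var 0) fun j => .var (j + 3)
    obtain ⟨c, hc, hmin⟩ := hD.exists_least hI hM hS (push (y + 1) (push i e)) hd
    have h1 : y + 1 ≤ code i (code (y + 1) c) := (left_le_code _ _).trans (right_le_code hM _ _)
    have h2 : c ≤ code i (code (y + 1) c) := (right_le_code hM _ _).trans (right_le_code hM _ _)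
    exact ⟨code i (code (y + 1) c), ((hM _ _).2 le_rfl).trans_le h1, hi, y + 1, (hM _ _).2 h1, c,
      (hM _ _).2 h2, rfl, hc, hmin⟩

include hM in
theorem IsStage.unique {k : M} {e : ℕ → M} {x i j : M} (hi : IsStage P k e x i)
    (hj : IsStage P k e x j) : i = j := by
  obtain ⟨-, b, -, d, -, h, -⟩ := hi
  obtain ⟨-, b', -, d', -, h', -⟩ := hj
  exact ((code_inj hM).1 (h.symm.trans h')).1

include hI hM hS hP in
/-- By the strong pigeonhole principle, `Π⁰₂` relations define sets below each bound. -/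
theorem BddDef.exists_set_of_satisfies_SPP (hSPP : S.Satisfies SPP) (e : ℕ → M) (k : M) :
    ∃ I ∈ S.sets, ∀ i, i < k → (i ∈ I ↔ ∀ b, ∃ m, ¬ P (push m (push b (push i e)))) := by
  -- The graph of the coloring: a stage gets its `i`, and every other `x` the spare color `k`, hence
  -- `k + 1` colors in all.
  have hC : BddDef S E fun v => ∃ x, x < v 0 + 1 ∧ ∃ i, i < v 0 + 1 ∧ v 0 = SOA.code x i ∧
      (IsStage P (v 1) (fun j => v (j + 2)) x i ∨
        i = v 1 ∧ ¬ ∃ j, j < v 1 ∧ IsStage P (v 1) (fun j => v (j + 2)) x j) :=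
    .exLt hI (.add_one hI (.var 0)) <| .exLt hI (.add_one hI (.var 1)) <|
    .and (.eq (.var 2) (.code hI (.var 1) (.var 0))) <|
    .or (hP.isStage hI (.var 3) (.var 1) (.var 0) fun j => .var (j + 4)) <|
    .and (.eq (.var 0) (.var 3)) <| .not <| .exLt hI (.var 3) <|
      hP.isStage hI (.var 4) (.var 2) (.var 0) fun j => .var (j + 5)
  have hCS := hC.comprehension hS (push k e)
  set C : Set M := {n | _} with hCdef
  have mem_code : ∀ x i, SOA.code x i ∈ C ↔ IsStage P k e x i ∨
      i = k ∧ ¬ ∃ j, j < k ∧ IsStage P k e x j := by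
    intro x i
    constructor
    · rintro ⟨x', -, i', -, h, h'⟩
      obtain ⟨rfl, rfl⟩ := (code_inj hM).1 h
      exact h'
    · exact fun h => ⟨x, (hM _ _).2 (left_le_code _ _), i, (hM _ _).2 (right_le_code hM _ _), rfl, h⟩
  have hk : k < k + 1 := (hM _ _).2 le_rfl
  obtain ⟨I, hIS, hI'⟩ := (satisfies_SPP S).1 hSPP (k + 1) C hCS
    (by
      rintro z ⟨x, -, i, -, hz, h⟩
      refine ⟨x, i, (hI.lt _ _).2 ?_, by rw [hI.pair]; exact hz⟩
      rcases h with h | h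
      · exact h.1.trans hk
      · exact h.1.trans_lt hk)
    (fun x => by
      simp only [hI.pair, mem_code]
      by_cases h : ∃ j, j < k ∧ IsStage P k e x j
      · obtain ⟨j, -, hj⟩ := h
        exact ⟨j, .inl hj⟩
      · exact ⟨k, .inr ⟨rfl, h⟩⟩)
    (fun x i j => by
      simp only [hI.pair, mem_code]
      rintro (h | ⟨rfl, h⟩) (h' | ⟨rfl, h'⟩)
      · exact h.unique hM h'
      · exact (h' ⟨i, h.1, h⟩).elim
      · exact (h ⟨j, h'.1, h'⟩).elim
      · rfl)
  refine ⟨I, hIS, fun i hi => ?_⟩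
  rw [hI', ← hP.forall_failsBelow_iff hI hM hS, ← hP.infinitely_many_stages_iff hI hM hS e hi]
  simp only [hI.pair, hI.lt, mem_code, hi.trans hk, hi.ne, false_and, or_false, true_and]

include hI hM hS in
theorem models_ISigma2_of_satisfies_SPP (hSPP : S.Satisfies SPP) : S.Models ISigma2 := by
  rintro _ ⟨_, ⟨θ, hθ, rfl⟩, rfl⟩
  rw [satisfies_inductionAxiom]
  intro e E zero succ n
  simp only [Formula.Realize, hI.zero, hI.one, hI.add] at zero succ ⊢
  by_contra hn
  have hP : BddDef S E fun v => θ.Realize S v E := ⟨θ, hθ, fun _ => Iff.rfl⟩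
  -- `I` collects the failures of the induction formula below `n + 1`, so that the assumed failure
  -- `n` is included.
  obtain ⟨I, hIS, hI'⟩ := hP.exists_set_of_satisfies_SPP hI hM hS hSPP e (n + 1)
  have hmem : ∀ i, i < n + 1 →
      (i ∈ I ↔ ¬ ∃ b, ∀ m, θ.Realize S (push m (push b (push i e))) E) := fun i hi => by
    rw [hI' i hi]
    push Not
    rfl
  have hQ : BddDef S (fun _ => ⟨I, hIS⟩) fun v => v 0 < v 1 + 1 → ¬ v 0 ∈ I :=
    .imp (.lt hI (.var 0) (.add_one hI (.var 1))) (.not (.mem 0 (.var 0)))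
  have hn' : n < n + 1 := (hM _ _).2 le_rfl
  refine hQ.induction hI hS (fun _ => n) (fun h => ?_) (fun i ih h => ?_) n hn'
    ((hmem n hn').2 hn)
  · exact fun H => (hmem 0 h).1 H zero
  · have hi : i < n + 1 := ((hM _ _).2 le_rfl : i < i + 1).trans h
    exact fun H => (hmem (i + 1) h).1 H (succ i (not_not.1 fun H' => ih hi ((hmem i hi).2 H')))

end

end Ordered

end SOA

/-- Over `RCA₀`, `Σ⁰₂`-induction is equivalent to the strong pigeonhole principle: in every model of
`RCA₀`, all instances of `Σ⁰₂`-induction hold if and only if `SPP` holds. -/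
theorem mainTheorem4 {M : Type*} (S : SOA.L2Structure M) (hS : S.Models SOA.RCA0) :
    S.Models SOA.ISigma2 ↔ S.Satisfies SOA.SPP := by
  obtain ⟨_, _, _, _, hI, hM⟩ := SOA.exists_orderedSemiring S hS
  refine ⟨fun h => ?_, SOA.models_ISigma2_of_satisfies_SPP hI hM hS⟩
  rw [SOA.satisfies_SPP]
  intro k C hC _ _ _
  simp only [hI.pair, hI.lt]
  exact SOA.exists_infinitely_often_set hI hM hS h k hC
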